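/- Let $p=(p_x)_{x\in\mathbb N}$, $\mathbb N=\{0,1,2,\dots\}$, be a probability mass function and let $X_1,X_2,\dots$ be i.i.d. $\mathbb N$-valued random variables with mass function $p$. For $n\ge 1$ let $\widehat p_{n,x}=n^{-1}\#\{i\le n: X_i=x\}$ be the empirical estimator, and put $M=\max\{X_1,\dots,X_n\}$. Let the rearrangement estimator $\widehat p_n^R$ be the vector $(\widehat p_{n,0},\dots,\widehat p_{n,M})$ sorted into decreasing order, and let the Grenander estimator (the MLE under monotonicity) $\widehat p_n^G$ be given by $\widehat p^G_{n,x}=L(x)-L(x-1)$, $0\le x\le M$, where $L$ is the least concave majorant on $[-1,M]$ of the points $(j,\sum_{i=0}^{j}\widehat p_{n,i})$, $j=-1,0,\dots,M$ (the empty sum is $0$); both are extended by $0$ to $x>M$. For $q,\tilde q:\mathbb N\to[0,\infty)$ let $H(q,\tilde q)=\big(\tfrac12\sum_{x\ge0}(\sqrt{q_x}-\sqrt{\tilde q_x})^2\big)^{1/2}$, $\|q-\tilde q\|_k=\big(\sum_{x\ge0}|q_x-\tilde q_x|^k\big)^{1/k}$ for real $k$ with $1\le k<\infty$, and $\|q-\tilde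 q\|_\infty=\sup_{x\ge0}|q_x-\tilde q_x|$. (i) If $p$ is monotone decreasing, i.e. $p_x\ge p_{x+1}$ for all $x$, then for every $n\ge1$ and every outcome of the sample $$\max\{H(\widehat p_n^G,p),H(\widehat p_n^R,p)\}\le H(\widehat p_n,p),\qquad \max\{\|\widehat p_n^G-p\|_k,\|\widehat p_n^R-p\|_k\}\le\|\widehat p_n-p\|_k,\quad 1\le k\le\infty.$$ (ii) If $p$ is the uniform distribution on $\{0,\dots,y\}$ for some $y\in\mathbb N$, then almost surely, for all $n\ge1$, $$H(\widehat p_n,p)=H(\widehat p_n^R,p),\qquad \|\widehat p_n^R-p\|_k=\|\widehat p_n-p\|_k,\quad 1\le k\le\infty.$$ (iii) For every $n\ge1$ and every outcome of the sample, if $\widehat p_n$ is monotone decreasing on $\mathbb N$ then $\widehat p_n^G=\widehat p_n^R=\widehat p_n$. If $p$ is the uniform distribution on $\{0,\dots,y\}$, $y\in\mathbb N$, then for every $n\ge 1$ the event that $\widehat p_n$ is monotone decreasing has probability $P(\widehat p_{n,0}\ge\widehat p_{n,1}\ge\cdots\ge\widehat p_{n,y})$, and $$P(\widehat p_{n,0}\ge\widehat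 p_{n,1}\ge\cdots\ge\widehat p_{n,y})\to\frac1{(y+1)!}\qquad(n\to\infty).$$ If instead the support of $p$ is $\{0,\dots,y\}$, $y\in\mathbb N$, and $p_0>p_1>\cdots>p_y$, then again, for every $n\ge1$, $\widehat p_n$ is monotone decreasing with probability $P(\widehat p_{n,0}\ge\widehat p_{n,1}\ge\cdots\ge\widehat p_{n,y})$, and this probability tends to $1$ as $n\to\infty$. -/

import Mathlib

open MeasureTheory ProbabilityTheory Filter Topology
open scoped ENNReal

noncomputable section

namespace MonotonePMF

/-- `p` is a probability mass function on `ℕ = {0, 1, 2, …}`. -/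
def IsMassFunction (p : ℕ → ℝ) : Prop :=
  (∀ x, 0 ≤ p x) ∧ HasSum p 1

/-- The uniform mass function on `{0, …, y}`. -/
def uniformMass (y : ℕ) (x : ℕ) : ℝ :=
  if x ≤ y then 1 / ((y : ℝ) + 1) else 0

/-- `X 0, X 1, …` are i.i.d. `ℕ`-valued random variables with mass function `p`. -/
structure IsIIDSample {Ω : Type*} [MeasurableSpace Ω] (P : Measure Ω)
    (X : ℕ → Ω → ℕ) (p : ℕ → ℝ) : Prop where
  measurable : ∀ i, Measurable (X i)
  indep : iIndepFun X P
  law : ∀ i x, P.real {ω | X i ω = x} = p x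

/-- The first `n` observations at the outcome `ω`. -/
def sample {Ω : Type*} (X : ℕ → Ω → ℕ) (n : ℕ) (ω : Ω) : Fin n → ℕ :=
  fun i => X i ω

/-! ### The operators `rear` and `gren` on vectors `(w_0, …, w_k)` -/

/-- The vector `w` sorted into decreasing order. -/
def rear {k : ℕ} (w : Fin (k + 1) → ℝ) : Fin (k + 1) → ℝ :=
  w ∘ Tuple.sort (OrderDual.toDual ∘ w)

/-- The least concave majorant, on the domain `D`, of a set `S` of points of the plane: the
pointwise infimum of all concave functions on `D` whose graph lies above all points of `S`. -/
def leastConcaveMajorant (D : Set ℝ) (S : Set (ℝ × ℝ)) (t : ℝ) : ℝ :=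
  sInf {v | ∃ g : ℝ → ℝ, ConcaveOn ℝ D g ∧ (∀ q ∈ S, q.2 ≤ g q.1) ∧ v = g t}

/-- The points `(j, ∑_{i ≤ j} w_i)`, `j = -1, 0, …, k`; here `m = j + 1` runs over `0, …, k + 1`. -/
def cumulativePoints {k : ℕ} (w : Fin (k + 1) → ℝ) : Set (ℝ × ℝ) :=
  {q | ∃ m : ℕ, m ≤ k + 1 ∧
    q = ((m : ℝ) - 1, ∑ i : Fin (k + 1), if (i : ℕ) < m then w i else 0)}

/-- The `k + 1` successive slopes of the least concave majorant of `cumulativePoints w`. -/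
def gren {k : ℕ} (w : Fin (k + 1) → ℝ) : Fin (k + 1) → ℝ := fun x =>
  leastConcaveMajorant (Set.Icc (-1) (k : ℝ)) (cumulativePoints w) ((x : ℕ) : ℝ) -
    leastConcaveMajorant (Set.Icc (-1) (k : ℝ)) (cumulativePoints w) (((x : ℕ) : ℝ) - 1)

/-- A vector `(w_0, …, w_k)` viewed as a sequence on `ℕ` that vanishes beyond `k`. -/
def extendZero {k : ℕ} (w : Fin (k + 1) → ℝ) (x : ℕ) : ℝ :=
  if h : x < k + 1 then w ⟨x, h⟩ else 0

/-! ### The three estimators, for an observed sample `s` of size `n` -/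

/-- The empirical estimator `x ↦ n⁻¹ #{i : s i = x}`. -/
def empirical {n : ℕ} (s : Fin n → ℕ) (x : ℕ) : ℝ :=
  (n : ℝ)⁻¹ * ∑ i : Fin n, if s i = x then 1 else 0

/-- The largest observation. -/
def sampleMax {n : ℕ} (s : Fin n → ℕ) : ℕ :=
  Finset.univ.sup s

/-- The empirical estimator as a vector indexed by `{0, …, max s}`, which contains its support. -/
def empiricalVec {n : ℕ} (s : Fin n → ℕ) : Fin (sampleMax s + 1) → ℝ :=
  fun x => empirical s x

/-- The rearrangement estimator. -/
def rearrangement {n : ℕ} (s : Fin n → ℕ) : ℕ → ℝ :=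
  extendZero (rear (empiricalVec s))

/-- The Grenander estimator (the MLE under monotonicity). -/
def grenander {n : ℕ} (s : Fin n → ℕ) : ℕ → ℝ :=
  extendZero (gren (empiricalVec s))

/-! ### Distances -/

/-- The Hellinger distance: `H²(p, q) = 2⁻¹ ∑_x (√p_x - √q_x)²`. -/
def hellinger (p q : ℕ → ℝ) : ℝ≥0∞ :=
  (2⁻¹ * ∑' x, ENNReal.ofReal ((√(p x) - √(q x)) ^ 2)) ^ (1 / 2 : ℝ)

/-- The `ℓ_k` distance, `1 ≤ k ≤ ∞`. -/
def ellDist (k : ℝ≥0∞) (p q : ℕ → ℝ) : ℝ≥0∞ :=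
  if k = ∞ then ⨆ x, ENNReal.ofReal |p x - q x|
  else (∑' x, ENNReal.ofReal |p x - q x| ^ k.toReal) ^ (1 / k.toReal)

/-- `q_0 ≥ q_1 ≥ ⋯ ≥ q_y`. -/
def DecreasingUpTo (y : ℕ) (q : ℕ → ℝ) : Prop :=
  ∀ x, x < y → q (x + 1) ≤ q x

end MonotonePMF

end

/-!
A Monge cost such as `(√a - √b) ^ 2`, or `f (a - b)` with `f` convex, is lowered by every swap that
brings two entries into the order of the decreasing `p`; sorting the empirical vector is a sequence
of such swaps. For the Grenander estimator, Abel summation expresses `∑ s_i (w_i - gren w i)`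
through the gaps between the cumulative sums of `w` and their least concave majorant. These gaps
vanish wherever the slope of the majorant changes, so the sum is nonnegative for every `s` that is
increasing where the slope is constant; subgradients of the cost provide such an `s`.

For the uniform distribution the empirical vector is exchangeable, and by the central limit theorem
it asymptotically has no ties, so each of the `(y + 1)!` orderings of its entries has the same
limiting probability. A strictly decreasing `p` is handled by the law of large numbers.
-/

noncomputable section

namespace MonotonePMF

/-! ### Convex costs and Monge costs -/

theorem exists_monotone_subgradient {f : ℝ → ℝ} (hf : ConvexOn ℝ Set.univ f) :
    ∃ s : ℝ → ℝ, Monotone s ∧ ∀ x y, f x + s x * (y - x) ≤ f y := by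
  have mem_interior (x : ℝ) : x ∈ interior (Set.univ : Set ℝ) := by simp
  refine ⟨fun x => derivWithin f (Set.Ioi x) x,
    fun x y hxy => hf.monotoneOn_rightDeriv (mem_interior x) (mem_interior y) hxy, fun x y => ?_⟩
  rcases lt_trichotomy x y with hxy | rfl | hyx
  · have right := hf.rightDeriv_le_slope_of_mem_interior (mem_interior x) (Set.mem_univ y) hxy
    rw [slope_def_field, le_div_iff₀ (sub_pos.2 hxy)] at right
    linarith
  · simp
  · have left := (hf.slope_le_leftDeriv_of_mem_interior (Set.mem_univ y) (mem_interior x) hyx).trans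
      (hf.leftDeriv_le_rightDeriv_of_mem_interior (mem_interior x))
    rw [slope_def_field, div_le_iff₀ (sub_pos.2 hyx)] at left
    linarith

/-- A cost has the Monge property if pairing two arguments in the same order is never more
expensive than pairing them in opposite order. -/
def IsMonge (c : ℝ → ℝ → ℝ) : Prop :=
  ∀ ⦃a a' b b' : ℝ⦄, a ≤ a' → b ≤ b' → c a b + c a' b' ≤ c a b' + c a' b

theorem isMonge_comp_sub {f : ℝ → ℝ} (hf : ConvexOn ℝ Set.univ f) :
    IsMonge fun a b => f (a - b) := by
  intro a a' b b' ha hb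
  obtain ⟨s, hs, subgradient⟩ := exists_monotone_subgradient hf
  rcases le_total (a - b) (a' - b') with h | h
  · nlinarith [subgradient (a - b) (a - b'), subgradient (a' - b') (a' - b),
      mul_le_mul_of_nonneg_right (hs h) (sub_nonneg.2 hb)]
  · nlinarith [subgradient (a - b) (a' - b), subgradient (a' - b') (a - b'),
      mul_le_mul_of_nonneg_right (hs h) (sub_nonneg.2 ha)]

theorem isMonge_sq_sqrt_sub : IsMonge fun a b => (√a - √b) ^ 2 := by
  intro a a' b b' ha hb
  nlinarith [mul_nonneg (sub_nonneg.2 (Real.sqrt_le_sqrt ha))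
    (sub_nonneg.2 (Real.sqrt_le_sqrt hb))]

/-- The vector `u` is at least as close to `v` as `w` is, for every convex cost of the
coordinatewise differences. This carries both estimators through all `ℓ_k` distances at once. -/
def ConvexCloser {ι : Type*} [Fintype ι] (u w v : ι → ℝ) : Prop :=
  ∀ f : ℝ → ℝ, ConvexOn ℝ Set.univ f → ∑ i, f (u i - v i) ≤ ∑ i, f (w i - v i)

/-! ### Decreasing rearrangement -/

theorem IsMonge.sum_comp_swap_le {ι : Type*} [Fintype ι] [DecidableEq ι] {c : ℝ → ℝ → ℝ}
    (hc : IsMonge c) {w v : ι → ℝ} {i j : ι} (hw : w i ≤ w j) (hv : v j ≤ v i) :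
    ∑ l, c ((w ∘ Equiv.swap i j) l) (v l) ≤ ∑ l, c (w l) (v l) := by
  obtain rfl | hij := eq_or_ne i j
  · simp
  rw [← sub_nonpos, ← Finset.sum_sub_distrib, Fintype.sum_eq_add i j hij fun l hl => by
    simp [Equiv.swap_apply_of_ne_of_ne hl.1 hl.2]]
  simp only [Function.comp_apply, Equiv.swap_apply_left, Equiv.swap_apply_right]
  linarith [hc hw hv]

variable {k : ℕ}

theorem IsMonge.sum_rear_le {c : ℝ → ℝ → ℝ} (hc : IsMonge c) (w : Fin (k + 1) → ℝ)
    {v : Fin (k + 1) → ℝ} (hv : Antitone v) :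
    ∑ i, c (rear w i) (v i) ≤ ∑ i, c (w i) (v i) :=
  Tuple.bubble_sort_induction (f := OrderDual.toDual ∘ w)
    (P := fun u => ∑ i, c (OrderDual.ofDual (u i)) (v i) ≤ ∑ i, c (w i) (v i)) le_rfl
    fun u _ _ hij hu ih =>
      (hc.sum_comp_swap_le (w := OrderDual.ofDual ∘ u) (OrderDual.ofDual_le_ofDual.2 hu.le)
        (hv hij.le)).trans ih

theorem convexCloser_rear (w : Fin (k + 1) → ℝ) {v : Fin (k + 1) → ℝ} (hv : Antitone v) :
    ConvexCloser (rear w) w v :=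
  fun _ hf => (isMonge_comp_sub hf).sum_rear_le w hv

theorem sum_cost_rear_of_forall_eq (c : ℝ → ℝ → ℝ) (w : Fin (k + 1) → ℝ) {v : Fin (k + 1) → ℝ}
    {b : ℝ} (hv : ∀ i, v i = b) : ∑ i, c (rear w i) (v i) = ∑ i, c (w i) (v i) := by
  simp only [hv]
  exact Equiv.sum_comp (Tuple.sort (OrderDual.toDual ∘ w)) fun i => c (w i) b

theorem rear_eq_self {w : Fin (k + 1) → ℝ} (hw : Antitone w) : rear w = w := by
  rw [rear, Tuple.sort_eq_refl_iff_monotone.2 hw.dual_right, Equiv.coe_refl, Function.comp_id]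

/-! ### The least concave majorant -/

/-- The functions `g` competing in the infimum that defines `leastConcaveMajorant D S`. -/
def IsConcaveMajorant (D : Set ℝ) (S : Set (ℝ × ℝ)) (g : ℝ → ℝ) : Prop :=
  ConcaveOn ℝ D g ∧ ∀ q ∈ S, q.2 ≤ g q.1

section LeastConcaveMajorant

variable {D : Set ℝ} {S : Set (ℝ × ℝ)} {g : ℝ → ℝ}

theorem le_leastConcaveMajorant (hg : IsConcaveMajorant D S g) {t c : ℝ}
    (hc : ∀ h, IsConcaveMajorant D S h → c ≤ h t) : c ≤ leastConcaveMajorant D S t := by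
  refine le_csInf ⟨g t, g, hg.1, hg.2, rfl⟩ ?_
  rintro _ ⟨h, hconcave, hle, rfl⟩
  exact hc h ⟨hconcave, hle⟩

theorem leastConcaveMajorant_le (hg : IsConcaveMajorant D S g) {t c : ℝ}
    (hc : ∀ h, IsConcaveMajorant D S h → c ≤ h t) : leastConcaveMajorant D S t ≤ g t := by
  refine csInf_le ⟨c, ?_⟩ ⟨g, hg.1, hg.2, rfl⟩
  rintro _ ⟨h, hconcave, hle, rfl⟩
  exact hc h ⟨hconcave, hle⟩

theorem concaveOn_leastConcaveMajorant {c : ℝ} (hg : IsConcaveMajorant D S g)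
    (hc : ∀ h, IsConcaveMajorant D S h → ∀ t ∈ D, c ≤ h t) :
    ConcaveOn ℝ D (leastConcaveMajorant D S) := by
  refine ⟨hg.1.1, fun x hx y hy a b ha hb hab => le_leastConcaveMajorant hg fun h hh => ?_⟩
  refine le_trans ?_ (hh.1.2 hx hy ha hb hab)
  gcongr
  · exact leastConcaveMajorant_le hh fun h' hh' => hc h' hh' x hx
  · exact leastConcaveMajorant_le hh fun h' hh' => hc h' hh' y hy

theorem IsConcaveMajorant.min_le {a b α β t : ℝ} (hg : IsConcaveMajorant (Set.Icc a b) S g)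
    (ha : (a, α) ∈ S) (hb : (b, β) ∈ S) (ht : t ∈ Set.Icc a b) : min α β ≤ g t :=
  have hab : a ≤ b := ht.1.trans ht.2
  (min_le_min (hg.2 _ ha) (hg.2 _ hb)).trans
    (hg.1.min_le_of_mem_Icc (Set.left_mem_Icc.2 hab) (Set.right_mem_Icc.2 hab) ht)

end LeastConcaveMajorant

/-! ### Cumulative sums and their majorant -/

@[simp]
theorem extendZero_val (w : Fin (k + 1) → ℝ) (i : Fin (k + 1)) : extendZero w i = w i :=
  dif_pos i.isLt

theorem extendZero_of_le (w : Fin (k + 1) → ℝ) {x : ℕ} (hx : k + 1 ≤ x) : extendZero w x = 0 :=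
  dif_neg hx.not_gt

/-- The sum of the first `m` entries of `w`, that is, the height of the point of
`cumulativePoints w` with abscissa `m - 1`. -/
def cumulative (w : Fin (k + 1) → ℝ) (m : ℕ) : ℝ :=
  ∑ x ∈ Finset.range m, extendZero w x

/-- The height at `m - 1` of the least concave majorant of the cumulative sums of `w`; the shift
of the argument matches `cumulative`. -/
def majorant (w : Fin (k + 1) → ℝ) (m : ℕ) : ℝ :=
  leastConcaveMajorant (Set.Icc (-1) (k : ℝ)) (cumulativePoints w) ((m : ℝ) - 1)

theorem cumulative_succ (w : Fin (k + 1) → ℝ) (i : Fin (k + 1)) :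
    cumulative w (i + 1) = cumulative w i + w i := by
  rw [cumulative, Finset.sum_range_succ, extendZero_val, cumulative]

theorem cumulative_eq_sum_ite (w : Fin (k + 1) → ℝ) {m : ℕ} (hm : m ≤ k + 1) :
    cumulative w m = ∑ i : Fin (k + 1), if (i : ℕ) < m then w i else 0 := by
  have h := Fin.sum_univ_eq_sum_range (fun x => if x < m then extendZero w x else 0) (k + 1)
  simp only [extendZero_val] at h
  rw [h, ← Finset.sum_filter, cumulative]
  congr 1
  ext x
  simp only [Finset.mem_range, Finset.mem_filter]
  omega

theorem cumulativePoints_eq_image (w : Fin (k + 1) → ℝ) :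
    cumulativePoints w = (fun m : ℕ => ((m : ℝ) - 1, cumulative w m)) '' Set.Iic (k + 1) := by
  ext q
  refine exists_congr fun m => and_congr_right fun hm => ?_
  rw [← cumulative_eq_sum_ite w hm, eq_comm]

theorem sum_range_le_sum_range {u : ℕ → ℝ} {a j : ℕ} (nonneg : ∀ l < a, 0 ≤ u l)
    (nonpos : ∀ l < j, a ≤ l → u l ≤ 0) :
    ∑ l ∈ Finset.range j, u l ≤ ∑ l ∈ Finset.range a, u l := by
  rcases le_total j a with h | h
  · exact Finset.sum_le_sum_of_subset_of_nonneg (Finset.range_mono h)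
      fun l hl _ => nonneg l (Finset.mem_range.1 hl)
  · rw [← Finset.sum_range_add_sum_Ico u h]
    exact add_le_of_nonpos_right (Finset.sum_nonpos fun l hl =>
      nonpos l (Finset.mem_Ico.1 hl).2 (Finset.mem_Ico.1 hl).1)

theorem cumulative_le_add_mul {w : Fin (k + 1) → ℝ} {a j : ℕ} {b : ℝ} (ha : a ≤ k + 1)
    (hj : j ≤ k + 1) (left : ∀ i : Fin (k + 1), (i : ℕ) < a → b ≤ w i)
    (right : ∀ i : Fin (k + 1), a ≤ i → w i ≤ b) :
    cumulative w j ≤ cumulative w a + b * (j - a) := by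
  have h := sum_range_le_sum_range (u := fun l => extendZero w l - b) (a := a) (j := j)
    (fun l hl => by simpa [extendZero, hl.trans_le ha] using left ⟨l, hl.trans_le ha⟩ hl)
    (fun l hl hal => by simpa [extendZero, hl.trans_le hj] using right ⟨l, hl.trans_le hj⟩ hal)
  simp only [Finset.sum_sub_distrib, Finset.sum_const, Finset.card_range, nsmul_eq_mul] at h
  simp only [cumulative]
  linarith

theorem isConcaveMajorant_affine {w : Fin (k + 1) → ℝ} {a b : ℝ}
    (h : ∀ m ≤ k + 1, cumulative w m ≤ a + b * m) :
    IsConcaveMajorant (Set.Icc (-1) (k : ℝ)) (cumulativePoints w) fun t => a + b * (t + 1) := by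
  refine ⟨⟨convex_Icc _ _, fun x _ y _ c d _ _ hcd => le_of_eq ?_⟩, ?_⟩
  · simp only [smul_eq_mul]
    linear_combination (a + b) * hcd
  · rw [cumulativePoints_eq_image, Set.forall_mem_image]
    intro m hm
    simpa using h m hm

theorem exists_isConcaveMajorant (w : Fin (k + 1) → ℝ) :
    ∃ g, IsConcaveMajorant (Set.Icc (-1) (k : ℝ)) (cumulativePoints w) g := by
  obtain ⟨i, hi⟩ := Finite.exists_max w
  refine ⟨_, isConcaveMajorant_affine (a := cumulative w 0) (b := w i) fun m hm => ?_⟩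
  simpa using cumulative_le_add_mul (Nat.zero_le _) hm
    (fun j hj => absurd hj (Nat.not_lt_zero j)) fun j _ => hi j

variable (w : Fin (k + 1) → ℝ)

theorem min_cumulative_le (g : ℝ → ℝ)
    (hg : IsConcaveMajorant (Set.Icc (-1) (k : ℝ)) (cumulativePoints w) g)
    {t : ℝ} (ht : t ∈ Set.Icc (-1) (k : ℝ)) :
    min (cumulative w 0) (cumulative w (k + 1)) ≤ g t := by
  refine hg.min_le ?_ ?_ ht <;> rw [cumulativePoints_eq_image]
  · exact ⟨0, Nat.zero_le _, by simp⟩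
  · exact ⟨k + 1, Set.mem_Iic.2 le_rfl, by simp⟩

theorem concaveOn_leastConcaveMajorant_cumulativePoints :
    ConcaveOn ℝ (Set.Icc (-1) (k : ℝ))
      (leastConcaveMajorant (Set.Icc (-1) (k : ℝ)) (cumulativePoints w)) :=
  have ⟨_, hg⟩ := exists_isConcaveMajorant w
  concaveOn_leastConcaveMajorant hg fun h hh _ ht => min_cumulative_le w h hh ht

theorem natCast_sub_one_mem_Icc {m : ℕ} (hm : m ≤ k + 1) :
    (m : ℝ) - 1 ∈ Set.Icc (-1) (k : ℝ) := by
  have : (m : ℝ) ≤ k + 1 := by exact_mod_cast hm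
  exact ⟨by linarith [(m.cast_nonneg : (0 : ℝ) ≤ m)], by linarith⟩

theorem gren_apply (i : Fin (k + 1)) : gren w i = majorant w (i + 1) - majorant w i := by
  simp [gren, majorant]

theorem antitone_gren : Antitone (gren w) := by
  cases k with
  | zero => exact Subsingleton.antitone (α := Fin 1) _
  | succ k =>
    refine Fin.antitone_iff_succ_le.2 fun i => ?_
    have h := (concaveOn_leastConcaveMajorant_cumulativePoints w).slope_anti_adjacent
      (x := ((i : ℕ) : ℝ) - 1) (y := ((i + 1 : ℕ) : ℝ) - 1) (z := ((i + 1 + 1 : ℕ) : ℝ) - 1)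
      (natCast_sub_one_mem_Icc (by omega)) (natCast_sub_one_mem_Icc (by omega))
      (by push_cast; linarith) (by push_cast; linarith)
    rw [gren_apply, gren_apply]
    have hi : (((i + 1 + 1 : ℕ) : ℝ) - 1) - (((i + 1 : ℕ) : ℝ) - 1) = 1 := by push_cast; ring
    have hi' : (((i + 1 : ℕ) : ℝ) - 1) - (((i : ℕ) : ℝ) - 1) = 1 := by push_cast; ring
    simpa only [majorant, Fin.val_succ, Fin.val_castSucc, hi, hi', div_one] using h

variable {w}

theorem cumulative_le_majorant {m : ℕ} (hm : m ≤ k + 1) : cumulative w m ≤ majorant w m := by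
  obtain ⟨_, hg⟩ := exists_isConcaveMajorant w
  refine le_leastConcaveMajorant hg fun h hh => hh.2 ((m : ℝ) - 1, cumulative w m) ?_
  rw [cumulativePoints_eq_image]
  exact ⟨m, hm, rfl⟩

theorem majorant_le_affine {a b : ℝ} (h : ∀ j ≤ k + 1, cumulative w j ≤ a + b * j) {m : ℕ}
    (hm : m ≤ k + 1) : majorant w m ≤ a + b * m := by
  simpa [majorant] using leastConcaveMajorant_le (isConcaveMajorant_affine h)
    fun g hg => min_cumulative_le w g hg (natCast_sub_one_mem_Icc hm)

theorem majorant_eq_cumulative_of_supporting {m : ℕ} (hm : m ≤ k + 1) {b : ℝ}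
    (left : ∀ i : Fin (k + 1), (i : ℕ) < m → b ≤ w i)
    (right : ∀ i : Fin (k + 1), m ≤ i → w i ≤ b) : majorant w m = cumulative w m := by
  refine le_antisymm ?_ (cumulative_le_majorant hm)
  have h := majorant_le_affine (w := w) (a := cumulative w m - b * m) (b := b)
    (fun j hj => by linarith [cumulative_le_add_mul hm hj left right]) hm
  linarith

variable (w)

theorem majorant_zero : majorant w 0 = 0 := by
  obtain ⟨i, hi⟩ := Finite.exists_max w
  rw [majorant_eq_cumulative_of_supporting (Nat.zero_le _)
    (fun j hj => absurd hj (Nat.not_lt_zero j)) fun j _ => hi j, cumulative, Finset.sum_range_zero]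

theorem majorant_last : majorant w (k + 1) = cumulative w (k + 1) := by
  obtain ⟨i, hi⟩ := Finite.exists_min w
  exact majorant_eq_cumulative_of_supporting le_rfl (fun j _ => hi j)
    fun j hj => absurd j.isLt hj.not_gt

theorem cumulative_gren {m : ℕ} (hm : m ≤ k + 1) : cumulative (gren w) m = majorant w m := by
  rw [← sub_zero (majorant w m), ← majorant_zero w, ← Finset.sum_range_sub, cumulative]
  refine Finset.sum_congr rfl fun x hx => ?_
  have hx : x < k + 1 := (Finset.mem_range.1 hx).trans_le hm
  rw [extendZero, dif_pos hx, gren_apply]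

variable {w}

theorem gren_eq_self (hw : Antitone w) : gren w = w := by
  funext i
  rw [gren_apply, majorant_eq_cumulative_of_supporting (b := w i) i.isLt
      (fun j hj => hw (Fin.le_def.2 (by omega))) (fun j hj => hw (Fin.le_def.2 (by omega))),
    majorant_eq_cumulative_of_supporting (b := w i) i.isLt.le
      (fun j hj => hw (Fin.le_def.2 (by omega))) (fun j hj => hw (Fin.le_def.2 (by omega))),
    cumulative_succ, add_sub_cancel_left]

theorem majorant_le_add_gren_mul (w : Fin (k + 1) → ℝ) {a j : ℕ} (ha : a ≤ k + 1)
    (hj : j ≤ k + 1) (i : Fin (k + 1)) (hia : (i : ℕ) ≤ a) (hai : a ≤ i + 1) :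
    majorant w j ≤ majorant w a + gren w i * (j - a) := by
  simpa only [cumulative_gren w ha, cumulative_gren w hj] using
    cumulative_le_add_mul (w := gren w) ha hj
      (fun l hl => antitone_gren w (Fin.le_def.2 (by omega)))
      (fun l hl => antitone_gren w (Fin.le_def.2 (by omega)))

theorem majorant_eq_cumulative_of_gren_lt {i j : Fin (k + 1)} (hij : (j : ℕ) = i + 1)
    (hlt : gren w j < gren w i) : majorant w j = cumulative w j := by
  refine le_antisymm ?_ (cumulative_le_majorant j.isLt.le)
  by_contra! gap
  -- The line of average slope through the kink lies above the majorant at all other points by at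
  -- least half the drop in slope, so it can be lowered by `δ` and still lie above all sums.
  set b := (gren w i + gren w j) / 2
  set ε := (gren w i - gren w j) / 2
  set δ := min ε (majorant w j - cumulative w j)
  have hε : 0 < ε := half_pos (sub_pos.2 hlt)
  have hδ : 0 < δ := lt_min hε (sub_pos.2 gap)
  have lowered (l : ℕ) (hl : l ≤ k + 1) :
      cumulative w l ≤ majorant w j - b * j - δ + b * l := by
    have le_majorant := cumulative_le_majorant (w := w) hl
    have hδε : δ ≤ ε := min_le_left _ _
    rcases lt_trichotomy l j with h | rfl | h
    · have tangent := majorant_le_add_gren_mul w j.isLt.le hl i (by omega) (by omega)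
      have : (l : ℝ) + 1 ≤ j := by exact_mod_cast h
      have slope : gren w i = b + ε := by simp only [b, ε]; ring
      rw [slope] at tangent
      nlinarith
    · linarith [min_le_right ε (majorant w j - cumulative w j)]
    · have tangent := majorant_le_add_gren_mul w j.isLt.le hl j le_rfl (by omega)
      have : (j : ℝ) + 1 ≤ l := by exact_mod_cast h
      have slope : gren w j = b - ε := by simp only [b, ε]; ring
      rw [slope] at tangent
      nlinarith
  linarith [majorant_le_affine lowered j.isLt.le]

/-! ### Contraction by the slopes of the majorant -/

theorem sum_mul_sub_gren_nonneg {s : Fin (k + 1) → ℝ}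
    (hs : ∀ i j, i ≤ j → gren w i = gren w j → s i ≤ s j) :
    0 ≤ ∑ i, s i * (w i - gren w i) := by
  set gap : ℕ → ℝ := fun x => extendZero w x - extendZero (gren w) x
  have sum_gap {m : ℕ} (hm : m ≤ k + 1) :
      ∑ x ∈ Finset.range m, gap x = cumulative w m - majorant w m := by
    rw [← cumulative_gren w hm, Finset.sum_sub_distrib, cumulative, cumulative]
  have to_range : ∑ i, s i * (w i - gren w i) =
      ∑ x ∈ Finset.range (k + 1), extendZero s x • gap x := by
    rw [← Fin.sum_univ_eq_sum_range (fun x => extendZero s x • gap x)]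
    simp only [gap, extendZero_val, smul_eq_mul]
  rw [to_range, Finset.sum_range_by_parts, sum_gap le_rfl, majorant_last, sub_self, smul_zero,
    zero_sub, neg_nonneg, Nat.add_sub_cancel]
  refine Finset.sum_nonpos fun x hx => ?_
  have hx : x < k := Finset.mem_range.1 hx
  set i : Fin (k + 1) := ⟨x, by omega⟩
  set j : Fin (k + 1) := ⟨x + 1, by omega⟩
  have hij : i ≤ j := Fin.le_def.2 (Nat.le_succ x)
  rw [sum_gap (by omega), smul_eq_mul, extendZero_val s i, extendZero_val s j]
  rcases (antitone_gren w hij).eq_or_lt with h | h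
  · exact mul_nonpos_of_nonneg_of_nonpos (sub_nonneg.2 (hs i j hij h.symm))
      (sub_nonpos.2 (cumulative_le_majorant j.isLt.le))
  · rw [← majorant_eq_cumulative_of_gren_lt (i := i) (j := j) rfl h, sub_self, mul_zero]

theorem gren_eq_of_gren_le {c : ℝ} (hw : ∀ i, c ≤ w i) {i : Fin (k + 1)} (hi : gren w i ≤ c) :
    gren w i = w i := by
  have h := sum_mul_sub_gren_nonneg (w := w) (s := fun j => if gren w j ≤ c then -1 else 0)
    fun _ _ _ hg => by rw [hg]
  have nonpos (j : Fin (k + 1)) (_ : j ∈ Finset.univ) :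
      (if gren w j ≤ c then -1 else 0) * (w j - gren w j) ≤ 0 := by
    split_ifs with hj
    · linarith [hw j]
    · simp
  have hzero := (Finset.sum_eq_zero_iff_of_nonpos nonpos).1
    (le_antisymm (Finset.sum_nonpos nonpos) h) i (Finset.mem_univ i)
  rw [if_pos hi] at hzero
  linarith

theorem le_gren {c : ℝ} (hw : ∀ i, c ≤ w i) (i : Fin (k + 1)) : c ≤ gren w i := by
  by_contra! h
  exact h.not_ge (gren_eq_of_gren_le hw h.le ▸ hw i)

variable {v : Fin (k + 1) → ℝ}

theorem sum_cost_gren_le {c s : ℝ → ℝ → ℝ} (hs : ∀ a, Antitone (s a)) (hv : Antitone v)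
    (hc : ∀ i, c (gren w i) (v i) + s (gren w i) (v i) * (w i - gren w i) ≤ c (w i) (v i)) :
    ∑ i, c (gren w i) (v i) ≤ ∑ i, c (w i) (v i) := by
  have h := sum_mul_sub_gren_nonneg (w := w) (s := fun i => s (gren w i) (v i))
    fun i j hij hg => hg ▸ hs _ (hv hij)
  calc ∑ i, c (gren w i) (v i)
      ≤ ∑ i, (c (gren w i) (v i) + s (gren w i) (v i) * (w i - gren w i)) := by
        rw [Finset.sum_add_distrib]
        exact le_add_of_nonneg_right h
    _ ≤ ∑ i, c (w i) (v i) := Finset.sum_le_sum fun i _ => hc i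

theorem convexCloser_gren (hv : Antitone v) : ConvexCloser (gren w) w v := by
  intro f hf
  obtain ⟨s, hs, subgradient⟩ := exists_monotone_subgradient hf
  refine sum_cost_gren_le (c := fun a b => f (a - b)) (s := fun a b => s (a - b))
    (fun a b b' hb => hs (sub_le_sub_left hb a)) hv fun i => ?_
  simpa using subgradient (gren w i - v i) (w i - v i)

theorem sum_sq_sqrt_gren_le (hw : ∀ i, 0 ≤ w i) (hv : Antitone v) :
    ∑ i, (√(gren w i) - √(v i)) ^ 2 ≤ ∑ i, (√(w i) - √(v i)) ^ 2 := by
  -- The weight is the derivative of `a ↦ (√a - √b) ^ 2`, as a function of `b`.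
  refine sum_cost_gren_le (c := fun a b => (√a - √b) ^ 2) (s := fun a b => 1 - √b / √a)
    (fun a b b' hb => sub_le_sub_left (by gcongr) 1) hv fun i => ?_
  rcases (le_gren hw i).eq_or_lt with h | h
  · have := gren_eq_of_gren_le hw h.ge
    simp [← this]
  · have sqrt_pos : 0 < √(gren w i) := Real.sqrt_pos.2 h
    have defect : (√(w i) - √(v i)) ^ 2 - ((√(gren w i) - √(v i)) ^ 2 +
        (1 - √(v i) / √(gren w i)) * (√(w i) ^ 2 - √(gren w i) ^ 2)) =
        √(v i) / √(gren w i) * (√(w i) - √(gren w i)) ^ 2 := by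
      field_simp
      ring
    rw [Real.sq_sqrt (hw i), Real.sq_sqrt h.le] at defect
    rw [← sub_nonneg, defect]
    positivity

/-! ### Distances of vectors extended by zero -/

theorem tsum_extendZero (u : Fin (k + 1) → ℝ) (p : ℕ → ℝ) (F : ℝ → ℝ → ℝ≥0∞) :
    ∑' x, F (extendZero u x) (p x) = ∑ i, F (u i) (p i) + ∑' x, F 0 (p (x + (k + 1))) := by
  rw [← Summable.sum_add_tsum_nat_add' (k := k + 1) ENNReal.summable,
    ← Fin.sum_univ_eq_sum_range (fun x => F (extendZero u x) (p x))]
  simp only [extendZero_val, extendZero_of_le u (Nat.le_add_left _ _)]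

variable {u : Fin (k + 1) → ℝ} {p : ℕ → ℝ}

theorem tsum_ofReal_extendZero_le {c : ℝ → ℝ → ℝ} (nonneg : ∀ a b, 0 ≤ c a b)
    (h : ∑ i, c (u i) (p i) ≤ ∑ i, c (w i) (p i)) :
    ∑' x, ENNReal.ofReal (c (extendZero u x) (p x)) ≤
      ∑' x, ENNReal.ofReal (c (extendZero w x) (p x)) := by
  rw [tsum_extendZero u p fun a b => ENNReal.ofReal (c a b),
    tsum_extendZero w p fun a b => ENNReal.ofReal (c a b),
    ← ENNReal.ofReal_sum_of_nonneg fun _ _ => nonneg _ _,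
    ← ENNReal.ofReal_sum_of_nonneg fun _ _ => nonneg _ _]
  gcongr

theorem hellinger_extendZero_le
    (h : ∑ i, (√(u i) - √(p i)) ^ 2 ≤ ∑ i, (√(w i) - √(p i)) ^ 2) :
    hellinger (extendZero u) p ≤ hellinger (extendZero w) p := by
  have := tsum_ofReal_extendZero_le (c := fun a b => (√a - √b) ^ 2) (fun _ _ => sq_nonneg _) h
  unfold hellinger
  gcongr

theorem convexOn_abs_rpow {r : ℝ} (hr : 1 ≤ r) : ConvexOn ℝ Set.univ fun x : ℝ => |x| ^ r := by
  refine ⟨convex_univ, fun x _ y _ a b ha hb hab => ?_⟩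
  calc |a • x + b • y| ^ r
      ≤ (a • |x| + b • |y|) ^ r :=
        Real.rpow_le_rpow (abs_nonneg _)
          (convexOn_univ_norm.2 (Set.mem_univ x) (Set.mem_univ y) ha hb hab) (zero_le_one.trans hr)
    _ ≤ a • |x| ^ r + b • |y| ^ r :=
        (convexOn_rpow hr).2 (abs_nonneg x) (abs_nonneg y) ha hb hab

theorem convexOn_max_abs_sub (t : ℝ) : ConvexOn ℝ Set.univ fun x : ℝ => max (|x| - t) 0 :=
  ((convexOn_univ_norm (E := ℝ)).sub (concaveOn_const t convex_univ)).sup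
    (convexOn_const 0 convex_univ)

theorem ConvexCloser.abs_sub_le {ι : Type*} [Fintype ι] {u w v : ι → ℝ} (h : ConvexCloser u w v)
    {t : ℝ} (ht : ∀ i, |w i - v i| ≤ t) (i : ι) : |u i - v i| ≤ t := by
  have excess_le_zero : ∑ j, max (|u j - v j| - t) 0 ≤ 0 :=
    (h _ (convexOn_max_abs_sub t)).trans_eq
      (Finset.sum_eq_zero fun j _ => max_eq_right (sub_nonpos.2 (ht j)))
  have single_le := Finset.single_le_sum (f := fun j => max (|u j - v j| - t) 0)
    (fun j _ => le_max_right _ _) (Finset.mem_univ i)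
  exact sub_nonpos.1 ((le_max_left _ _).trans (single_le.trans excess_le_zero))

theorem ellDist_top_extendZero_le (h : ConvexCloser u w fun i => p i) :
    ellDist ∞ (extendZero u) p ≤ ellDist ∞ (extendZero w) p := by
  simp only [ellDist, if_true]
  obtain ⟨j, hj⟩ := Finite.exists_max fun i => |w i - p i|
  refine iSup_le fun x => ?_
  by_cases hx : x < k + 1
  · refine le_iSup_of_le (j : ℕ) (ENNReal.ofReal_le_ofReal ?_)
    rw [extendZero_val w j, extendZero, dif_pos hx]
    exact h.abs_sub_le hj ⟨x, hx⟩
  · refine le_iSup_of_le x ?_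
    rw [extendZero_of_le u (not_lt.1 hx), extendZero_of_le w (not_lt.1 hx)]

theorem ellDist_extendZero_le (h : ConvexCloser u w fun i => p i) {r : ℝ≥0∞} (hr : 1 ≤ r) :
    ellDist r (extendZero u) p ≤ ellDist r (extendZero w) p := by
  by_cases htop : r = ∞
  · exact htop ▸ ellDist_top_extendZero_le h
  have hr' : 1 ≤ r.toReal := by
    rwa [← ENNReal.ofReal_le_iff_le_toReal htop, ENNReal.ofReal_one]
  have := tsum_ofReal_extendZero_le (c := fun a b => |a - b| ^ r.toReal)
    (fun _ _ => by positivity) (h _ (convexOn_abs_rpow hr'))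
  simp only [ellDist, if_neg htop,
    ENNReal.ofReal_rpow_of_nonneg (abs_nonneg _) (zero_le_one.trans hr')]
  gcongr

/-! ### The estimators at a fixed outcome -/

variable {n : ℕ}

theorem empirical_nonneg (s : Fin n → ℕ) (x : ℕ) : 0 ≤ empirical s x :=
  mul_nonneg (by positivity) (Finset.sum_nonneg fun _ _ => by split_ifs <;> norm_num)

theorem empirical_eq_zero {s : Fin n → ℕ} {x : ℕ} (h : ∀ i, s i ≠ x) : empirical s x = 0 := by
  simp [empirical, h]

theorem le_sampleMax (s : Fin n → ℕ) (i : Fin n) : s i ≤ sampleMax s :=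
  Finset.le_sup (Finset.mem_univ i)

theorem extendZero_empiricalVec (s : Fin n → ℕ) : extendZero (empiricalVec s) = empirical s := by
  funext x
  rcases lt_or_ge x (sampleMax s + 1) with hx | hx
  · exact extendZero_val (empiricalVec s) ⟨x, hx⟩
  · rw [extendZero_of_le _ hx, empirical_eq_zero]
    rintro i rfl
    exact hx.not_gt (Nat.lt_succ_of_le (le_sampleMax s i))

section Antitone

variable (s : Fin n → ℕ) (hp : Antitone p)
include hp

theorem antitone_comp_val : Antitone fun i : Fin k => p i :=
  hp.comp_monotone (Fin.val_strictMono.monotone)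

theorem hellinger_grenander_le : hellinger (grenander s) p ≤ hellinger (empirical s) p := by
  rw [← extendZero_empiricalVec]
  exact hellinger_extendZero_le
    (sum_sq_sqrt_gren_le (fun i => empirical_nonneg s i) (antitone_comp_val hp))

theorem hellinger_rearrangement_le :
    hellinger (rearrangement s) p ≤ hellinger (empirical s) p := by
  rw [← extendZero_empiricalVec]
  exact hellinger_extendZero_le (isMonge_sq_sqrt_sub.sum_rear_le _ (antitone_comp_val hp))

theorem ellDist_grenander_le {r : ℝ≥0∞} (hr : 1 ≤ r) :
    ellDist r (grenander s) p ≤ ellDist r (empirical s) p := by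
  rw [← extendZero_empiricalVec]
  exact ellDist_extendZero_le (convexCloser_gren (antitone_comp_val hp)) hr

theorem ellDist_rearrangement_le {r : ℝ≥0∞} (hr : 1 ≤ r) :
    ellDist r (rearrangement s) p ≤ ellDist r (empirical s) p := by
  rw [← extendZero_empiricalVec]
  exact ellDist_extendZero_le (convexCloser_rear _ (antitone_comp_val hp)) hr

end Antitone

section Constant

variable {s : Fin n → ℕ} {c : ℝ} (hc : ∀ x ≤ sampleMax s, p x = c)
include hc

theorem sum_cost_rear_empiricalVec (F : ℝ → ℝ → ℝ) :
    ∑ i, F (rear (empiricalVec s) i) (p i) = ∑ i, F (empiricalVec s i) (p i) :=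
  sum_cost_rear_of_forall_eq F _ (v := fun i => p i) fun i => hc i (Nat.lt_succ_iff.1 i.isLt)

theorem hellinger_rearrangement_eq :
    hellinger (rearrangement s) p = hellinger (empirical s) p := by
  have h := sum_cost_rear_empiricalVec hc fun a b => (√a - √b) ^ 2
  rw [← extendZero_empiricalVec]
  exact le_antisymm (hellinger_extendZero_le h.le) (hellinger_extendZero_le h.ge)

theorem ellDist_rearrangement_eq {r : ℝ≥0∞} (hr : 1 ≤ r) :
    ellDist r (rearrangement s) p = ellDist r (empirical s) p := by
  have h (f : ℝ → ℝ) := sum_cost_rear_empiricalVec hc fun a b => f (a - b)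
  rw [← extendZero_empiricalVec]
  exact le_antisymm (ellDist_extendZero_le (fun f _ => (h f).le) hr)
    (ellDist_extendZero_le (fun f _ => (h f).ge) hr)

end Constant

theorem rearrangement_eq_empirical {s : Fin n → ℕ} (h : Antitone (empirical s)) :
    rearrangement s = empirical s := by
  have hvec : Antitone (empiricalVec s) := antitone_comp_val h
  rw [rearrangement, rear_eq_self hvec, extendZero_empiricalVec]

theorem grenander_eq_empirical {s : Fin n → ℕ} (h : Antitone (empirical s)) :
    grenander s = empirical s := by
  have hvec : Antitone (empiricalVec s) := antitone_comp_val h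
  rw [grenander, gren_eq_self hvec, extendZero_empiricalVec]

theorem antitone_empirical_iff {y : ℕ} {s : Fin n → ℕ} (hs : ∀ i, s i ≤ y) :
    Antitone (empirical s) ↔ DecreasingUpTo y (empirical s) := by
  refine ⟨fun h x _ => h (Nat.le_succ x), fun h => antitone_nat_of_succ_le fun x => ?_⟩
  rcases lt_or_ge x y with hx | hx
  · exact h x hx
  · rw [empirical_eq_zero fun i hi => by have := hs i; omega]
    exact empirical_nonneg s x

theorem decreasingUpTo_iff_antitone {y : ℕ} {q : ℕ → ℝ} :
    DecreasingUpTo y q ↔ Antitone fun a : Fin (y + 1) => q a :=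
  ⟨fun h => Fin.antitone_iff_succ_le.2 fun i => h i i.isLt,
    fun h x hx => Fin.antitone_iff_succ_le.1 h ⟨x, hx⟩⟩

/-! ### Exchangeable laws without ties -/

section Exchangeable

variable {m : ℕ} {α : Type*}

theorem injective_iff_exists_strictAnti_comp [LinearOrder α] {v : Fin m → α} :
    Function.Injective v ↔ ∃ σ : Equiv.Perm (Fin m), StrictAnti (v ∘ σ) := by
  constructor
  · intro h
    have sorted : Antitone (v ∘ Tuple.sort (OrderDual.toDual ∘ v)) :=
      fun _ _ hij => Tuple.monotone_sort (OrderDual.toDual ∘ v) hij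
    exact ⟨_, sorted.strictAnti_of_injective (h.comp (Equiv.injective _))⟩
  · rintro ⟨σ, hσ⟩
    exact (Equiv.injective_comp σ v).1 hσ.injective

theorem perm_eq_of_strictAnti_comp [LinearOrder α] {v : Fin m → α} {σ τ : Equiv.Perm (Fin m)}
    (hσ : StrictAnti (v ∘ σ)) (hτ : StrictAnti (v ∘ τ)) : σ = τ :=
  have hv : Function.Injective v := (Equiv.injective_comp σ v).1 hσ.injective
  Equiv.ext fun i => hv (congrFun (Tuple.unique_antitone hσ.antitone hτ.antitone) i)

theorem setOf_injective_eq_iUnion [LinearOrder α] :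
    {v : Fin m → α | Function.Injective v} =
      ⋃ σ : Equiv.Perm (Fin m), (fun v => v ∘ σ) ⁻¹' {v | StrictAnti v} := by
  ext v
  rw [Set.mem_iUnion]
  exact injective_iff_exists_strictAnti_comp

variable [MeasurableSpace α]

/-- A law on `ι → α` is exchangeable when it is invariant under every permutation of the
coordinates. -/
def IsExchangeable {ι : Type*} (μ : Measure (ι → α)) : Prop :=
  ∀ σ : Equiv.Perm ι, MeasurePreserving (fun v => v ∘ σ) μ μ

variable [LinearOrder α] [TopologicalSpace α] [OrderClosedTopology α]
  [SecondCountableTopology α] [OpensMeasurableSpace α]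

theorem measurableSet_strictAnti : MeasurableSet {v : Fin m → α | StrictAnti v} := by
  simp only [StrictAnti, Set.ofPred_forall]
  exact MeasurableSet.iInter fun a => MeasurableSet.iInter fun b => MeasurableSet.iInter fun _ =>
    measurableSet_lt (measurable_pi_apply b) (measurable_pi_apply a)

theorem measurableSet_antitone : MeasurableSet {v : Fin m → α | Antitone v} := by
  simp only [Antitone, Set.ofPred_forall]
  exact MeasurableSet.iInter fun a => MeasurableSet.iInter fun b => MeasurableSet.iInter fun _ =>
    measurableSet_le (measurable_pi_apply b) (measurable_pi_apply a)

theorem measurableSet_injective : MeasurableSet {v : Fin m → α | Function.Injective v} := by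
  have measurable_comp (σ : Equiv.Perm (Fin m)) : Measurable fun v : Fin m → α => v ∘ σ :=
    measurable_pi_lambda _ fun i => measurable_pi_apply (σ i)
  rw [setOf_injective_eq_iUnion]
  exact MeasurableSet.iUnion fun σ => measurable_comp σ measurableSet_strictAnti

theorem IsExchangeable.factorial_mul_measureReal_strictAnti {μ : Measure (Fin m → α)}
    [IsFiniteMeasure μ] (hμ : IsExchangeable μ) :
    (m.factorial : ℝ) * μ.real {v | StrictAnti v} = μ.real {v | Function.Injective v} := by
  have disjoint : Pairwise (Function.onFun Disjoint
      fun σ : Equiv.Perm (Fin m) => (fun v : Fin m → α => v ∘ σ) ⁻¹' {v | StrictAnti v}) :=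
    fun σ τ hne => Set.disjoint_left.2 fun v hσ hτ => hne (perm_eq_of_strictAnti_comp hσ hτ)
  rw [setOf_injective_eq_iUnion, measureReal_iUnion_fintype disjoint
    fun σ => (hμ σ).measurable measurableSet_strictAnti]
  simp only [fun σ => (hμ σ).measureReal_preimage measurableSet_strictAnti.nullMeasurableSet,
    Finset.sum_const, Finset.card_univ, Fintype.card_perm, Fintype.card_fin, nsmul_eq_mul]

theorem measureReal_not_injective_le_sum {β : Type*} [MeasurableSpace β]
    (μ : Measure (Fin m → β)) [IsFiniteMeasure μ] :
    μ.real {v | ¬ Function.Injective v} ≤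
      ∑ c ∈ (Finset.univ : Finset (Fin m)).offDiag, μ.real {v | v c.1 = v c.2} := by
  refine le_trans (measureReal_mono (fun v hv => ?_) (measure_ne_top μ _))
    (measureReal_biUnion_finset_le _ _)
  simp only [Set.mem_ofPred_eq, Function.Injective, not_forall] at hv
  obtain ⟨a, b, hab, hne⟩ := hv
  exact Set.mem_biUnion (x := (a, b)) (by simpa using hne) hab

variable {ι : Type*} {l : Filter ι} {μ : ι → Measure (Fin m → α)}
  [∀ i, IsProbabilityMeasure (μ i)]

theorem tendsto_measureReal_antitone_of_isExchangeable (hμ : ∀ i, IsExchangeable (μ i))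
    (ties : ∀ a b, a ≠ b → Tendsto (fun i => (μ i).real {v | v a = v b}) l (𝓝 0)) :
    Tendsto (fun i => (μ i).real {v | Antitone v}) l (𝓝 (1 / (m.factorial : ℝ))) := by
  have not_injective : Tendsto (fun i => (μ i).real {v | ¬ Function.Injective v}) l (𝓝 0) := by
    refine squeeze_zero (fun _ => measureReal_nonneg)
      (fun i => measureReal_not_injective_le_sum (μ i)) ?_
    simpa using tendsto_finsetSum (Finset.univ : Finset (Fin m)).offDiag fun c hc =>
      ties c.1 c.2 (Finset.mem_offDiag.1 hc).2.2
  have strict_eq (i : ι) : (1 - (μ i).real {v | ¬ Function.Injective v}) / m.factorial =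
      (μ i).real {v | StrictAnti v} := by
    rw [← Set.compl_ofPred, probReal_compl_eq_one_sub measurableSet_injective, sub_sub_cancel,
      ← (hμ i).factorial_mul_measureReal_strictAnti,
      mul_div_cancel_left₀ _ (Nat.cast_ne_zero.2 m.factorial_ne_zero)]
  have strict : Tendsto (fun i => (μ i).real {v | StrictAnti v}) l (𝓝 (1 / m.factorial)) := by
    simpa only [sub_zero, strict_eq] using (not_injective.const_sub 1).div_const (m.factorial : ℝ)
  refine tendsto_of_tendsto_of_tendsto_of_le_of_le strict
    (by simpa only [add_zero] using strict.add not_injective)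
    (fun i => measureReal_mono fun v (hv : StrictAnti v) => hv.antitone) fun i => ?_
  refine (measureReal_mono fun v (hv : Antitone v) => ?_).trans (measureReal_union_le _ _)
  exact or_iff_not_imp_right.2 fun h => hv.strictAnti_of_injective (not_not.1 h)

end Exchangeable

/-! ### Sums of independent variables at their mean -/

section Sums

variable {Ω : Type*} [MeasurableSpace Ω] {P : Measure Ω} [IsProbabilityMeasure P]

/- By the central limit theorem the normalised sums tend to a Gaussian, which has no atom at `0`. -/
theorem tendsto_measureReal_sum_eq_mul_integral {Z : ℕ → Ω → ℝ} (hZ : MemLp (Z 0) 2 P)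
    (hindep : iIndepFun Z P) (hident : ∀ i, IdentDistrib (Z i) (Z 0) P P)
    (hvar : Var[Z 0; P] ≠ 0) :
    Tendsto (fun n : ℕ => P.real {ω | ∑ i ∈ Finset.range n, Z i ω = n * ∫ ω, Z 0 ω ∂P})
      atTop (𝓝 0) := by
  have clt := tendstoInDistribution_inv_sqrt_mul_sum_sub (P := P) (X := Z)
    (P' := gaussianReal 0 Var[Z 0; P].toNNReal) (Y := id) HasLaw.id hZ hindep hident
  have toNNReal_ne_zero : Var[Z 0; P].toNNReal ≠ 0 := by
    rw [Ne, Real.toNNReal_eq_zero, not_le]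
    exact (variance_nonneg _ _).lt_of_ne' hvar
  have := nullSingletonClass_gaussianReal (μ := 0) toNNReal_ne_zero
  have portmanteau := ProbabilityMeasure.limsup_measure_closed_le_of_tendsto clt.tendsto
    (isClosed_singleton (x := (0 : ℝ)))
  simp only [ProbabilityMeasure.coe_mk, Measure.map_id, measure_singleton] at portmanteau
  have atom_zero := (ENNReal.tendsto_toReal ENNReal.zero_ne_top).comp
    (tendsto_of_le_liminf_of_limsup_le zero_le portmanteau)
  refine squeeze_zero (fun _ => measureReal_nonneg) (fun n => ?_) atom_zero
  rw [Function.comp_apply, Measure.map_apply_of_aemeasurable (clt.forall_aemeasurable n)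
    (measurableSet_singleton _)]
  exact measureReal_mono fun ω hω => mul_eq_zero_of_right _ (sub_eq_zero.2 hω)

end Sums

/-! ### Samples -/

/-- The vector `(empirical s 0, …, empirical s y)`, the initial part of the empirical estimator
whose law is exchangeable for samples from the uniform distribution on `{0, …, y}`. -/
def empiricalUpTo (y : ℕ) (s : Fin n → ℕ) : Fin (y + 1) → ℝ := fun a => empirical s a

theorem empirical_sample {Ω : Type*} (X : ℕ → Ω → ℕ) (n : ℕ) (ω : Ω) (x : ℕ) :
    empirical (sample X n ω) x =
      (∑ i ∈ Finset.range n, ({x} : Set ℕ).indicator 1 (X i ω)) / n := by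
  rw [empirical, inv_mul_eq_div,
    ← Fin.sum_univ_eq_sum_range fun i => ({x} : Set ℕ).indicator (1 : ℕ → ℝ) (X i ω)]
  congr! 2 with i
  by_cases h : X i ω = x <;> simp [sample, h]

theorem abs_indicator_one_le (S : Set ℕ) (m : ℕ) : |S.indicator (1 : ℕ → ℝ) m| ≤ 1 := by
  by_cases h : m ∈ S <;> simp [h]

theorem empirical_perm_comp (τ : Equiv.Perm ℕ) (s : Fin n → ℕ) (x : ℕ) :
    empirical (fun i => τ.symm (s i)) x = empirical s (τ x) := by
  simp only [empirical, Equiv.symm_apply_eq]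

theorem uniformMass_of_le {y x : ℕ} (h : x ≤ y) : uniformMass y x = 1 / ((y : ℝ) + 1) := if_pos h

theorem uniformMass_of_lt {y x : ℕ} (h : y < x) : uniformMass y x = 0 := if_neg h.not_ge

namespace IsIIDSample

variable {Ω : Type*} [MeasurableSpace Ω] {P : Measure Ω} {X Y : ℕ → Ω → ℕ}

theorem measurable_sample (hX : IsIIDSample P X p) (n : ℕ) : Measurable (sample X n) :=
  measurable_pi_lambda _ fun i => hX.measurable i

theorem measurable_empiricalUpTo_sample (hX : IsIIDSample P X p) (y n : ℕ) :
    Measurable fun ω => empiricalUpTo y (sample X n ω) :=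
  (measurable_of_countable (empiricalUpTo y)).comp (hX.measurable_sample n)

theorem comp_perm (hX : IsIIDSample P X p) (τ : Equiv.Perm ℕ) :
    IsIIDSample P (fun i ω => τ (X i ω)) (p ∘ τ.symm) where
  measurable i := (measurable_of_countable τ).comp (hX.measurable i)
  indep := hX.indep.comp (fun _ => τ) fun _ => measurable_of_countable τ
  law i x := by simp only [← Equiv.eq_symm_apply, hX.law, Function.comp_apply]

theorem integral_indicator (hX : IsIIDSample P X p) (i x : ℕ) :
    ∫ ω, ({x} : Set ℕ).indicator (1 : ℕ → ℝ) (X i ω) ∂P = p x := by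
  have measurableSet_eq : MeasurableSet {ω | X i ω = x} :=
    hX.measurable i (measurableSet_singleton x)
  rw [← hX.law i x, ← integral_indicator_one measurableSet_eq]
  rfl

theorem measureReal_decreasingUpTo_eq (hX : IsIIDSample P X p) (y n : ℕ) :
    P.real {ω | DecreasingUpTo y (empirical (sample X n ω))} =
      (P.map fun ω => empiricalUpTo y (sample X n ω)).real {v | Antitone v} := by
  rw [map_measureReal_apply (hX.measurable_empiricalUpTo_sample y n) measurableSet_antitone]
  simp only [decreasingUpTo_iff_antitone]
  rfl

variable [IsProbabilityMeasure P]

theorem integrable_comp (hX : IsIIDSample P X p) (i : ℕ) {φ : ℕ → ℝ} {C : ℝ}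
    (hφ : ∀ m, |φ m| ≤ C) : Integrable (fun ω => φ (X i ω)) P :=
  .of_bound ((measurable_of_countable φ).comp (hX.measurable i)).aestronglyMeasurable C
    (ae_of_all _ fun _ => hφ _)

theorem identDistrib (hX : IsIIDSample P X p) (hY : IsIIDSample P Y p)
    (i j : ℕ) : IdentDistrib (X i) (Y j) P P where
  aemeasurable_fst := (hX.measurable i).aemeasurable
  aemeasurable_snd := (hY.measurable j).aemeasurable
  map_eq := Measure.ext_of_singleton fun x => by
    rw [← measureReal_eq_measureReal_iff,
      map_measureReal_apply (hX.measurable i) (measurableSet_singleton x),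
      map_measureReal_apply (hY.measurable j) (measurableSet_singleton x)]
    exact (hX.law i x).trans (hY.law j x).symm

theorem identDistrib_sample (hX : IsIIDSample P X p)
    (hY : IsIIDSample P Y p) (n : ℕ) : IdentDistrib (sample X n) (sample Y n) P P :=
  IdentDistrib.pi (fun i : Fin n => hX.identDistrib hY i i)
    (hX.indep.precomp Fin.val_injective) (hY.indep.precomp Fin.val_injective)

theorem ae_le (hX : IsIIDSample P X p) {y : ℕ}
    (hp : ∀ x, y < x → p x = 0) : ∀ᵐ ω ∂P, ∀ i, X i ω ≤ y := by
  have ae_ne (i x : ℕ) (hx : y < x) : ∀ᵐ ω ∂P, X i ω ≠ x := by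
    simpa [hp x hx, measureReal_eq_zero_iff, ae_iff] using hX.law i x
  filter_upwards [ae_all_iff.2 fun i => ae_all_iff.2 fun x => ae_all_iff.2 (ae_ne i x)]
    with ω hω i
  by_contra! hlt
  exact hω i _ hlt rfl

theorem measureReal_antitone_eq (hX : IsIIDSample P X p) {y : ℕ}
    (hp : ∀ x, y < x → p x = 0) (n : ℕ) :
    P.real {ω | Antitone (empirical (sample X n ω))} =
      P.real {ω | DecreasingUpTo y (empirical (sample X n ω))} := by
  refine measureReal_congr ?_
  filter_upwards [hX.ae_le hp] with ω hω
  exact propext (antitone_empirical_iff fun i => hω i)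

/-! ### Consistency -/

theorem ae_tendsto_empirical (hX : IsIIDSample P X p) :
    ∀ᵐ ω ∂P, ∀ x, Tendsto (fun n => empirical (sample X n ω) x) atTop (𝓝 (p x)) := by
  refine ae_all_iff.2 fun x => ?_
  have measurable_indicator : Measurable (({x} : Set ℕ).indicator (1 : ℕ → ℝ)) :=
    measurable_of_countable _
  have strong_law := strong_law_ae_real (fun i ω => ({x} : Set ℕ).indicator (1 : ℕ → ℝ) (X i ω))
    (hX.integrable_comp 0 (abs_indicator_one_le {x}))
    (fun i j hij => (hX.indep.indepFun hij).comp measurable_indicator measurable_indicator)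
    fun i => (hX.identDistrib hX i 0).comp measurable_indicator
  simpa only [hX.integral_indicator 0 x, ← empirical_sample] using strong_law

theorem tendsto_decreasingUpTo_of_strictAntiOn (hX : IsIIDSample P X p) {y : ℕ}
    (hp : StrictAntiOn p (Set.Iic y)) :
    Tendsto (fun n : ℕ => P.real {ω | DecreasingUpTo y (empirical (sample X n ω))})
      atTop (𝓝 1) := by
  have measurableSet_decreasing (n : ℕ) :
      MeasurableSet {ω | DecreasingUpTo y (empirical (sample X n ω))} :=
    hX.measurable_sample n (MeasurableSet.of_discrete (s := {s | DecreasingUpTo y (empirical s)}))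
  have eventually_decreasing : ∀ᵐ ω ∂P, ∀ᶠ n in atTop,
      DecreasingUpTo y (empirical (sample X n ω)) := by
    filter_upwards [hX.ae_tendsto_empirical] with ω hω
    refine (eventually_all_finite (Set.finite_Iio y)).2 fun x (hx : x < y) => ?_
    have hlt : p (x + 1) < p x := hp hx.le (Set.mem_Iic.2 hx) x.lt_succ_self
    exact ((hω (x + 1)).eventually_lt (hω x) hlt).mono fun n hn => hn.le
  have tendsto_measure := tendsto_measure_of_ae_tendsto_indicator_of_isFiniteMeasure (μ := P) atTop
    MeasurableSet.univ measurableSet_decreasing (by simpa using eventually_decreasing)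
  rw [measure_univ] at tendsto_measure
  exact (ENNReal.tendsto_toReal ENNReal.one_ne_top).comp tendsto_measure

/-! ### Constant mass functions -/

theorem tendsto_measureReal_empirical_eq (hX : IsIIDSample P X p) {a b : ℕ} (hab : a ≠ b)
    (hp : p a = p b) (hpos : 0 < p a) :
    Tendsto (fun n : ℕ => P.real {ω | empirical (sample X n ω) a = empirical (sample X n ω) b})
      atTop (𝓝 0) := by
  set φ : ℕ → ℝ := ({a} : Set ℕ).indicator 1 - ({b} : Set ℕ).indicator 1 with hφ
  have measurable_φ : Measurable φ := measurable_of_countable _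
  have abs_φ_le (m : ℕ) : |φ m| ≤ 1 + 1 :=
    (abs_sub _ _).trans (add_le_add (abs_indicator_one_le _ m) (abs_indicator_one_le _ m))
  have integral_φ : ∫ ω, φ (X 0 ω) ∂P = 0 := by
    simp only [hφ, Pi.sub_apply]
    rw [integral_sub (hX.integrable_comp 0 (abs_indicator_one_le {a}))
      (hX.integrable_comp 0 (abs_indicator_one_le {b})), hX.integral_indicator,
      hX.integral_indicator, hp, sub_self]
  have memLp_φ : MemLp (fun ω => φ (X 0 ω)) 2 P :=
    .of_bound (measurable_φ.comp (hX.measurable 0)).aestronglyMeasurable _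
      (ae_of_all _ fun ω => abs_φ_le _)
  have variance_φ : Var[fun ω => φ (X 0 ω); P] ≠ 0 := by
    intro h
    have ae_eq_zero : ∀ᵐ ω ∂P, φ (X 0 ω) = 0 :=
      integral_φ ▸ ae_eq_integral_of_variance_eq_zero memLp_φ h
    refine hpos.ne' ((hX.law 0 a).symm.trans ((measureReal_eq_zero_iff).2 ?_))
    refine measure_mono_null (fun ω (hω : X 0 ω = a) => ?_) (ae_iff.1 ae_eq_zero)
    simp [hφ, hω, hab]
  have sums := tendsto_measureReal_sum_eq_mul_integral (Z := fun i ω => φ (X i ω)) memLp_φ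
    (hX.indep.comp (fun _ => φ) fun _ => measurable_φ)
    (fun i => (hX.identDistrib hX i 0).comp measurable_φ) variance_φ
  simp only [integral_φ, mul_zero] at sums
  refine sums.congr' ?_
  filter_upwards [eventually_ne_atTop 0] with n hn
  simp only [empirical_sample, div_left_inj' (Nat.cast_ne_zero.2 hn : (n : ℝ) ≠ 0), hφ,
    Pi.sub_apply, Finset.sum_sub_distrib, sub_eq_zero]

theorem isExchangeable_map_empiricalUpTo (hX : IsIIDSample P X p) {y : ℕ} {c : ℝ}
    (hp : ∀ x ≤ y, p x = c) (n : ℕ) :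
    IsExchangeable (P.map fun ω => empiricalUpTo y (sample X n ω)) := by
  intro σ
  let τ : Equiv.Perm ℕ := σ.viaFintypeEmbedding Fin.valEmbedding
  have τ_apply (a : Fin (y + 1)) : τ a = σ a :=
    Equiv.Perm.viaFintypeEmbedding_apply_image σ Fin.valEmbedding a
  have comp_τ : p ∘ τ = p := by
    funext x
    rcases lt_or_ge x (y + 1) with hx | hx
    · rw [Function.comp_apply, τ_apply ⟨x, hx⟩, hp _ (Nat.lt_succ_iff.1 (σ _).isLt),
        hp x (Nat.lt_succ_iff.1 hx)]
    · refine congrArg p (Equiv.Perm.viaFintypeEmbedding_apply_notMem_range _ _ ?_)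
      rintro ⟨a, rfl⟩
      exact hx.not_gt a.isLt
  have permuted : IsIIDSample P (fun i ω => τ.symm (X i ω)) p :=
    comp_τ ▸ hX.comp_perm τ.symm
  have measurable_comp : Measurable fun v : Fin (y + 1) → ℝ => v ∘ σ :=
    measurable_pi_lambda _ fun a => measurable_pi_apply (σ a)
  refine ⟨measurable_comp, ?_⟩
  rw [Measure.map_map measurable_comp (hX.measurable_empiricalUpTo_sample y n)]
  have same_law := ((permuted.identDistrib_sample hX n).comp
    (measurable_of_countable (empiricalUpTo y))).map_eq
  convert! same_law using 2
  funext ω a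
  exact (congrArg _ (τ_apply a).symm).trans (empirical_perm_comp τ (sample X n ω) a).symm

theorem tendsto_decreasingUpTo_of_forall_eq (hX : IsIIDSample P X p) {y : ℕ} {c : ℝ} (hc : 0 < c)
    (hp : ∀ x ≤ y, p x = c) :
    Tendsto (fun n : ℕ => P.real {ω | DecreasingUpTo y (empirical (sample X n ω))})
      atTop (𝓝 (1 / ((y + 1).factorial : ℝ))) := by
  have (n : ℕ) := Measure.isProbabilityMeasure_map (μ := P)
    (hX.measurable_empiricalUpTo_sample y n).aemeasurable
  have p_eq (a : Fin (y + 1)) : p a = c := hp a (Nat.lt_succ_iff.1 a.isLt)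
  simp only [hX.measureReal_decreasingUpTo_eq]
  refine tendsto_measureReal_antitone_of_isExchangeable
    (hX.isExchangeable_map_empiricalUpTo hp) fun a b hab => ?_
  have map_eq (n : ℕ) := map_measureReal_apply (μ := P) (hX.measurable_empiricalUpTo_sample y n)
    (measurableSet_eq_fun (measurable_pi_apply a) (measurable_pi_apply b))
  simp only [map_eq]
  exact hX.tendsto_measureReal_empirical_eq (Fin.val_injective.ne hab)
    ((p_eq a).trans (p_eq b).symm) (hc.trans_eq (p_eq a).symm)

end IsIIDSample

end MonotonePMF

end

theorem mainTheorem1 {Ω : Type*} [MeasurableSpace Ω] (P : Measure Ω) [IsProbabilityMeasure P]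
    (X : ℕ → Ω → ℕ) (p : ℕ → ℝ) (hp : MonotonePMF.IsMassFunction p)
    (hX : MonotonePMF.IsIIDSample P X p) :
    -- (i)
    (Antitone p → ∀ n : ℕ, 1 ≤ n → ∀ ω : Ω,
      max (MonotonePMF.hellinger (MonotonePMF.grenander (MonotonePMF.sample X n ω)) p)
          (MonotonePMF.hellinger (MonotonePMF.rearrangement (MonotonePMF.sample X n ω)) p)
        ≤ MonotonePMF.hellinger (MonotonePMF.empirical (MonotonePMF.sample X n ω)) p ∧
      ∀ k : ℝ≥0∞, 1 ≤ k →
        max (MonotonePMF.ellDist k (MonotonePMF.grenander (MonotonePMF.sample X n ω)) p)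
            (MonotonePMF.ellDist k (MonotonePMF.rearrangement (MonotonePMF.sample X n ω)) p)
          ≤ MonotonePMF.ellDist k (MonotonePMF.empirical (MonotonePMF.sample X n ω)) p) ∧
    -- (ii)
    (∀ y : ℕ, p = MonotonePMF.uniformMass y → ∀ᵐ ω ∂P, ∀ n : ℕ, 1 ≤ n →
      MonotonePMF.hellinger (MonotonePMF.empirical (MonotonePMF.sample X n ω)) p
        = MonotonePMF.hellinger (MonotonePMF.rearrangement (MonotonePMF.sample X n ω)) p ∧
      ∀ k : ℝ≥0∞, 1 ≤ k →
        MonotonePMF.ellDist k (MonotonePMF.rearrangement (MonotonePMF.sample X n ω)) p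
          = MonotonePMF.ellDist k (MonotonePMF.empirical (MonotonePMF.sample X n ω)) p) ∧
    -- (iii), coincidence of the three estimators
    (∀ n : ℕ, 1 ≤ n → ∀ ω : Ω,
      Antitone (MonotonePMF.empirical (MonotonePMF.sample X n ω)) →
        MonotonePMF.grenander (MonotonePMF.sample X n ω)
          = MonotonePMF.rearrangement (MonotonePMF.sample X n ω) ∧
        MonotonePMF.rearrangement (MonotonePMF.sample X n ω)
          = MonotonePMF.empirical (MonotonePMF.sample X n ω)) ∧
    -- (iii), uniform distribution
    (∀ y : ℕ, p = MonotonePMF.uniformMass y →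
      (∀ n : ℕ, 1 ≤ n →
        P.real {ω | Antitone (MonotonePMF.empirical (MonotonePMF.sample X n ω))}
          = P.real {ω | MonotonePMF.DecreasingUpTo y
              (MonotonePMF.empirical (MonotonePMF.sample X n ω))}) ∧
      Tendsto (fun n : ℕ => P.real {ω | MonotonePMF.DecreasingUpTo y
          (MonotonePMF.empirical (MonotonePMF.sample X n ω))})
        atTop (𝓝 (1 / ((y + 1).factorial : ℝ)))) ∧
    -- (iii), strictly decreasing mass function with support `{0, …, y}`
    (∀ y : ℕ, StrictAntiOn p (Set.Iic y) → Function.support p = Set.Iic y →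
      (∀ n : ℕ, 1 ≤ n →
        P.real {ω | Antitone (MonotonePMF.empirical (MonotonePMF.sample X n ω))}
          = P.real {ω | MonotonePMF.DecreasingUpTo y
              (MonotonePMF.empirical (MonotonePMF.sample X n ω))}) ∧
      Tendsto (fun n : ℕ => P.real {ω | MonotonePMF.DecreasingUpTo y
          (MonotonePMF.empirical (MonotonePMF.sample X n ω))})
        atTop (𝓝 1)) := by
  have p_le_of_uniform (y : ℕ) (hy : p = MonotonePMF.uniformMass y) (x : ℕ) (hx : x ≤ y) :
      p x = 1 / ((y : ℝ) + 1) := hy ▸ MonotonePMF.uniformMass_of_le hx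
  have p_lt_of_uniform (y : ℕ) (hy : p = MonotonePMF.uniformMass y) (x : ℕ) (hx : y < x) :
      p x = 0 := hy ▸ MonotonePMF.uniformMass_of_lt hx
  refine ⟨fun hanti n _ ω => ⟨?_, fun k hk => ?_⟩, fun y hy => ?_, fun n _ ω h => ?_,
    fun y hy => ⟨fun n _ => hX.measureReal_antitone_eq (p_lt_of_uniform y hy) n, ?_⟩,
    fun y hstrict hsupp => ⟨fun n _ => hX.measureReal_antitone_eq (fun x hx => ?_) n,
      hX.tendsto_decreasingUpTo_of_strictAntiOn hstrict⟩⟩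
  · exact max_le (MonotonePMF.hellinger_grenander_le _ hanti)
      (MonotonePMF.hellinger_rearrangement_le _ hanti)
  · exact max_le (MonotonePMF.ellDist_grenander_le _ hanti hk)
      (MonotonePMF.ellDist_rearrangement_le _ hanti hk)
  · filter_upwards [hX.ae_le (p_lt_of_uniform y hy)] with ω hω n _
    have constant (x : ℕ) (hx : x ≤ MonotonePMF.sampleMax (MonotonePMF.sample X n ω)) :=
      p_le_of_uniform y hy x (hx.trans (Finset.sup_le fun i _ => hω i))
    exact ⟨(MonotonePMF.hellinger_rearrangement_eq constant).symm,
      fun k hk => MonotonePMF.ellDist_rearrangement_eq constant hk⟩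
  · simp only [MonotonePMF.grenander_eq_empirical h, MonotonePMF.rearrangement_eq_empirical h,
      and_self]
  · exact hX.tendsto_decreasingUpTo_of_forall_eq (by positivity) (p_le_of_uniform y hy)
  · exact Function.notMem_support.1 fun hmem => (hsupp ▸ hmem : x ∈ Set.Iic y).not_gt hx
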